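/- \textbf{Setting.} An instance of Fair Division with Externalities consists of a finite set $N=\{1,\dots,n\}$ of agents, a finite set $A=\{a_1,\dots,a_m\}$ of indivisible items, and a real value $V_i(j,a)$ for all $i,j\in N$ and $a\in A$ (the value that agent $i$ gets if item $a$ is allocated to agent $j$). An allocation $\pi=(\pi_1,\dots,\pi_n)$ is a partition of $A$ into $n$ possibly empty bundles, $\pi(a)$ is the agent who receives $a$, and $V_i(\pi)=\sum_{a\in A}V_i(\pi(a),a)$. For $a\in A$ let $\pi-a$ be the partial allocation with bundles $\pi_\ell\setminus\{a\}$, whose value $V_i(\pi-a)$ is the same sum over $A\setminus\{a\}$. For a (partial) allocation $\lambda$ let $\lambda^{i\leftrightarrow j}$ be obtained from it by swapping the bundles of $i$ and $j$. The allocation $\pi$ is \emph{EFX} if for all $i,j\in N$ with $V_i(\pi)<V_i(\pi^{i\leftrightarrow j})$ and every $a\in A$, writing $\lambda=\pi-a$, $$V_i(\lambda)-V_i(\lambda^{i\leftrightarrow j})>V_i(\pi)-V_i(\pi^{i\leftrightarrow j})\quad\Longrightarrow\quad V_i(\lambda)\ge V_i(\lambda^{i\leftrightarrow j}).$$ The valuations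 are \emph{binary} if $V_i(j,a)\in\{0,1\}$ for all $i,j,a$. An item $a$ is a \emph{weak-chore} for agent $i$ if $V_i(i,a)<V_i(j,a)$ for some agent $j$; there are no weak-chores if no item is a weak-chore for any agent. \textbf{Theorem.} Every instance of Fair Division with Externalities with three agents, binary valuations and no weak-chores admits an EFX allocation. Moreover, such an allocation can be computed in polynomial time: there is a Turing machine that, given any such instance (written as the list of the $3\times 3$ tables $(V_i(j,a))_{i,j}$ of its items), outputs an EFX allocation of it (written as the list of the agents who receive the items) in a number of steps bounded by a polynomial in the length of the input. -/

import Mathlib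

namespace FairDivision

/-- An instance of fair division with additive externalities, with `n` agents and `numItems`
indivisible items: `V i j a` is the value that agent `i` gets if item `a` is allocated to
agent `j`. -/
structure Instance (n : ℕ) where
  numItems : ℕ
  V : Fin n → Fin n → Fin numItems → ℝ

namespace Instance

variable {n : ℕ}

/-- An allocation, i.e. a partition of all items into `n` possibly empty bundles, is given by the
map that sends each item to the agent who receives it. -/
abbrev Allocation (I : Instance n) : Type := Fin I.numItems → Fin n

/-- The value of agent `i` from the part of the allocation `π` that concerns the items in `S`,
that is, the value of the partial allocation whose bundles are the sets `π_ℓ ∩ S`. -/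
noncomputable def valueOn (I : Instance n) (S : Finset (Fin I.numItems)) (i : Fin n)
    (π : I.Allocation) : ℝ :=
  ∑ a ∈ S, I.V i (π a) a

/-- The value of agent `i` from the allocation `π`. -/
noncomputable def value (I : Instance n) (i : Fin n) (π : I.Allocation) : ℝ :=
  I.valueOn Finset.univ i π

/-- The value of agent `i` once the item `a` is removed from the allocation `π`, that is, the
value of the partial allocation whose bundles are the sets `π_ℓ \ {a}`. -/
noncomputable def valueWithout (I : Instance n) (a : Fin I.numItems) (i : Fin n)
    (π : I.Allocation) : ℝ :=
  I.valueOn (Finset.univ.erase a) i π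

/-- The allocation in which the agents `i` and `j` have swapped their bundles. -/
def swapBundles (I : Instance n) (π : I.Allocation) (i j : Fin n) : I.Allocation :=
  fun a => Equiv.swap i j (π a)

/-- Envy-freeness up to any item: whenever `i` envies `j`, the removal of any single item that
strictly decreases this envy eliminates it. -/
def IsEFX (I : Instance n) (π : I.Allocation) : Prop :=
  ∀ i j : Fin n, I.value i π < I.value i (I.swapBundles π i j) →
    ∀ a : Fin I.numItems,
      I.valueWithout a i π - I.valueWithout a i (I.swapBundles π i j)
          > I.value i π - I.value i (I.swapBundles π i j) →
        I.valueWithout a i π ≥ I.valueWithout a i (I.swapBundles π i j)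

/-- All values are `0` or `1`. -/
def IsBinary (I : Instance n) : Prop :=
  ∀ i j a, I.V i j a = 0 ∨ I.V i j a = 1

/-- Item `a` is a weak-chore for agent `i`. -/
def IsWeakChore (I : Instance n) (i : Fin n) (a : Fin I.numItems) : Prop :=
  ∃ j : Fin n, I.V i i a < I.V i j a

/-- No item is a weak-chore for any agent. -/
def NoWeakChores (I : Instance n) : Prop :=
  ∀ i a, ¬ I.IsWeakChore i a

end Instance

/-- The instances with `n` agents, binary valuations and no weak-chores. -/
def BinaryNoChoreInstance (n : ℕ) : Type :=
  {I : Instance n // I.IsBinary ∧ I.NoWeakChores}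

/-- The item-type of an item in a binary instance: the `n × n` table of bits that says which of
the values `V i j a` are equal to `1`. For a fixed number of agents this is a fixed finite
alphabet. -/
abbrev ItemType (n : ℕ) : Type := Fin n → Fin n → Bool

/-- A binary instance as an input word: the list of the item-types of its items, one symbol for
each item. -/
noncomputable def encodeInstance {n : ℕ} (I : BinaryNoChoreInstance n) : List (ItemType n) :=
  List.ofFn fun a i j => decide (I.1.V i j a = 1)

/-- An allocation of `m` items as an output word: the list of the agents who receive the items,
one symbol for each item. -/
def encodeAllocation {n : ℕ} (π : Σ m : ℕ, (Fin m → Fin n)) : List (Fin n) :=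
  List.ofFn π.2

/-- The input word determines the instance. -/
theorem encodeInstance_injective {n : ℕ} :
    Function.Injective (encodeInstance (n := n)) := by
  rintro ⟨⟨m, V⟩, hV, hc⟩ ⟨⟨m', V'⟩, hV', hc'⟩ h
  have hm : m = m' := by simpa [encodeInstance] using congrArg List.length h
  subst hm
  have h2 := List.ofFn_injective h
  have h3 : V = V' := by
    funext i j a
    have := congrFun (congrFun (congrFun h2 a) i) j
    simp only [decide_eq_decide] at this
    have h0 := hV i j a
    have h0' := hV' i j a
    simp only at h0 h0'
    rcases h0 with h0 | h0 <;> rcases h0' with h0' | h0' <;> simp_all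
  subst h3
  rfl

/-- The assignment `f` of an allocation to each binary instance with `n` agents and no weak-chores
is computed, in a number of steps bounded by a polynomial in the length of the input word, by a
multi-stack Turing machine all of whose alphabets are finite. -/
def ComputableInPolyTime {n : ℕ} (f : (I : BinaryNoChoreInstance n) → I.1.Allocation) : Prop :=
  ∃ M : Turing.TM2ComputableInPolyTime encodeInstance encodeAllocation
      (fun I : BinaryNoChoreInstance n => (⟨I.1.numItems, f I⟩ : Σ m : ℕ, (Fin m → Fin n))),
    ∀ k, Finite (M.tm.Γ k)

end FairDivision

/-! Consider the advantage V_i(π) − V_i(π^{i↔j}) of `i` over `j`. With binary values and no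
weak-chores, an item `a` contributes to it only if V_i(i,a) = 1 and V_i(j,a) = 0, and then it adds 1
if `i` receives it and −1 if `j` does (`effect_eq_sub`). So all six advantages are integers, and an
allocation is EFX as soon as all are at least −1: a removal that strictly raises such an integer
makes it nonnegative (`isEFX_of_balanced`).

That such an allocation always exists is `exists_balance_ge`. Advantages add up over disjoint sets
of items, so a nonempty part that can be assigned with nonnegative advantages may be split off and
the rest treated by induction. What remains are multisets without such a part. Only six preference
bits of an item matter, so there are 64 kinds of items, and a search evaluated by the kernel
(`search_allCodes`, interpreted by `search_sound`) shows that these multisets have at most six items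
and can all be assigned with advantages at least −1.

For the algorithm, three items of one type given to three different agents cancel (`sum_effect`), so
only the number of items of each type modulo 3 matters. There are finitely many vectors of
remainders, and a table with one good assignment for each is built into the finite control of a
machine. It counts in one pass and allocates in a second one, in linear time. -/

namespace FairDivision

/-! ### Balances of assigned items -/

/-- Agent `i` strictly prefers that an item of type `t` goes to herself rather than to `j`. -/
def prefers (t : ItemType 3) (i j : Fin 3) : Bool := t i i && !t i j

/-- The change of the advantage of agent `i` over agent `j` (in the eyes of `i`) when an item of
type `t` is given to agent `p`. -/
def effect (t : ItemType 3) (p i j : Fin 3) : ℤ :=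
  if prefers t i j then (if p = i then 1 else if p = j then -1 else 0) else 0

/-- The advantage of agent `i` over agent `j` (in the eyes of `i`) in a multiset of items that are
assigned to agents. -/
def balance (s : Multiset (ItemType 3 × Fin 3)) (i j : Fin 3) : ℤ :=
  (s.map fun x => effect x.1 x.2 i j).sum

theorem balance_zero (i j : Fin 3) : balance 0 i j = 0 := rfl

theorem balance_cons (x : ItemType 3 × Fin 3) (s : Multiset (ItemType 3 × Fin 3)) (i j : Fin 3) :
    balance (x ::ₘ s) i j = effect x.1 x.2 i j + balance s i j := by
  simp [balance]

theorem balance_add (s s' : Multiset (ItemType 3 × Fin 3)) (i j : Fin 3) :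
    balance (s + s') i j = balance s i j + balance s' i j := by
  simp [balance]

theorem balance_self (s : Multiset (ItemType 3 × Fin 3)) (i : Fin 3) : balance s i i = 0 := by
  simp [balance, effect, prefers]

theorem abs_effect_le (t : ItemType 3) (p i j : Fin 3) :
    -1 ≤ effect t p i j ∧ effect t p i j ≤ 1 := by
  unfold effect
  split_ifs <;> simp

theorem abs_balance_le (s : Multiset (ItemType 3 × Fin 3)) (i j : Fin 3) :
    -(s.card : ℤ) ≤ balance s i j ∧ balance s i j ≤ s.card := by
  induction s using Multiset.induction_on with
  | empty => simp [balance_zero]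
  | cons x s ih =>
    have := abs_effect_le x.1 x.2 i j
    rw [balance_cons, Multiset.card_cons]
    push_cast
    omega

/-- If `i` prefers the item, the three recipients contribute 1, −1 and 0. This makes the round-robin
part of the algorithm neutral. -/
theorem sum_effect (t : ItemType 3) (i j : Fin 3) :
    effect t 0 i j + effect t 1 i j + effect t 2 i j = 0 := by
  unfold effect
  cases h : prefers t i j
  · simp
  · have : i ≠ j := by rintro rfl; simp [prefers] at h
    simp only [if_true]
    revert this
    clear h
    revert i j
    decide

/-! ### Balances packed into natural numbers

The six balances `b` of a small multiset are packed into the natural number with the base-64 digits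
`32 + b`, so that `b` is nonnegative exactly if the top bit of its digit is set. -/

/-- The natural number all of whose six base-64 digits are `1`. -/
def unitCode : ℕ := 1090785345

/-- The natural number all of whose six base-64 digits are `32`. -/
def signMask : ℕ := 34905131040

/-- All packed balances are nonnegative. -/
def isNonneg (v : ℕ) : Bool := Nat.beq (Nat.land v signMask) signMask

/-- The packed effects of an item when it is given to each of the three agents, where an effect
`e` has the base-64 digit `1 + e`. -/
abbrev ItemCode := ℕ × ℕ × ℕ

/-- The code of an item from the preferences of the agents. -/
def encodePrefs (a b c d e f : Bool) : ItemCode :=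
  (unitCode + a.toNat + 64 * b.toNat - 64 ^ 2 * c.toNat - 64 ^ 4 * e.toNat,
   unitCode + 64 ^ 2 * c.toNat + 64 ^ 3 * d.toNat - a.toNat - 64 ^ 5 * f.toNat,
   unitCode + 64 ^ 4 * e.toNat + 64 ^ 5 * f.toNat - 64 * b.toNat - 64 ^ 3 * d.toNat)

/-- The code of an item of type `t`. -/
def itemCode (t : ItemType 3) : ItemCode :=
  encodePrefs (prefers t 0 1) (prefers t 0 2) (prefers t 1 0) (prefers t 1 2) (prefers t 2 0)
    (prefers t 2 1)

/-- The part of an item code that concerns agent `p`. -/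
def ItemCode.get (x : ItemCode) : Fin 3 → ℕ := ![x.1, x.2.1, x.2.2]

/-- The packed balances after an item with the packed effects `c` is added. -/
def addCode (v c : ℕ) : ℕ := v + c - unitCode

/-- The linear combination of six numbers that is used for packing. -/
def packSum (b : Fin 3 → Fin 3 → ℤ) : ℤ :=
  b 0 1 + 64 * b 0 2 + 64 ^ 2 * b 1 0 + 64 ^ 3 * b 1 2 + 64 ^ 4 * b 2 0 + 64 ^ 5 * b 2 1

theorem itemCode_get (t : ItemType 3) (p : Fin 3) :
    ((itemCode t).get p : ℤ) = unitCode + packSum (effect t p) := by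
  unfold itemCode packSum effect
  generalize prefers t 0 1 = a
  generalize prefers t 0 2 = b
  generalize prefers t 1 0 = c
  generalize prefers t 1 2 = d
  generalize prefers t 2 0 = e
  generalize prefers t 2 1 = f
  revert a b c d e f p
  decide +kernel

/-- The natural number `v` packs the balances of `s`. -/
def Packs (v : ℕ) (s : Multiset (ItemType 3 × Fin 3)) : Prop :=
  (v : ℤ) = signMask + packSum (balance s)

theorem packs_zero : Packs signMask 0 := by
  simp [Packs, packSum, balance_zero]

/-- The bound on the card keeps every digit of `v` at least 2, so the truncated subtraction in
`addCode` is exact. -/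
theorem Packs.cons {v : ℕ} {s : Multiset (ItemType 3 × Fin 3)} (h : Packs v s)
    (hs : s.card ≤ 30) (t : ItemType 3) (p : Fin 3) :
    Packs (addCode v ((itemCode t).get p)) ((t, p) ::ₘ s) := by
  have hc := itemCode_get t p
  have hb := fun i j => abs_balance_le s i j
  have h01 := hb 0 1
  have h02 := hb 0 2
  have h10 := hb 1 0
  have h12 := hb 1 2
  have h20 := hb 2 0
  have h21 := hb 2 1
  unfold Packs at *
  simp only [packSum, balance_cons, unitCode, signMask, addCode] at *
  omega

theorem isNonneg_digits {v : ℕ} (h : isNonneg v = true) (k : ℕ)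
    (hk : signMask.testBit k = true) : v / 2 ^ k % 2 = 1 := by
  have h1 : v &&& signMask = signMask := Nat.eq_of_beq_eq_true h
  have h2 : (v &&& signMask).testBit k = true := by rw [h1, hk]
  rw [Nat.testBit_and, Bool.and_eq_true] at h2
  simpa [Nat.testBit_eq_decide_div_mod_eq] using h2.1

/-- The numbers `32 + b i j` lie between 0 and 63, so there are no carries and they are the true
base-64 digits of `v`. -/
theorem nonneg_of_isNonneg {v : ℕ} {b : Fin 3 → Fin 3 → ℤ} (hv : (v : ℤ) = signMask + packSum b)
    (hb : ∀ i j, -32 ≤ b i j ∧ b i j ≤ 31) (h : isNonneg v = true) (i j : Fin 3) (hij : i ≠ j) :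
    0 ≤ b i j := by
  have h01 := hb 0 1
  have h02 := hb 0 2
  have h10 := hb 1 0
  have h12 := hb 1 2
  have h20 := hb 2 0
  have h21 := hb 2 1
  -- Bit `6 * k + 5` is the top bit of the base-64 digit number `k`.
  have k0 := isNonneg_digits h 5 (by decide)
  have k1 := isNonneg_digits h 11 (by decide)
  have k2 := isNonneg_digits h 17 (by decide)
  have k3 := isNonneg_digits h 23 (by decide)
  have k4 := isNonneg_digits h 29 (by decide)
  have k5 := isNonneg_digits h 35 (by decide)
  simp only [packSum, signMask] at hv
  have key : 0 ≤ b 0 1 ∧ 0 ≤ b 0 2 ∧ 0 ≤ b 1 0 ∧ 0 ≤ b 1 2 ∧ 0 ≤ b 2 0 ∧ 0 ≤ b 2 1 := by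
    generalize b 0 1 = b0 at *
    generalize b 0 2 = b1 at *
    generalize b 1 0 = b2 at *
    generalize b 1 2 = b3 at *
    generalize b 2 0 = b4 at *
    generalize b 2 1 = b5 at *
    norm_num at hv k0 k1 k2 k3 k4 k5
    refine ⟨?_, ?_, ?_, ?_, ?_, ?_⟩
    · clear k1 k2 k3 k4 k5; omega
    · clear k0 k2 k3 k4 k5; omega
    · clear k0 k1 k3 k4 k5; omega
    · clear k0 k1 k2 k4 k5; omega
    · clear k0 k1 k2 k3 k5; omega
    · clear k0 k1 k2 k3 k4; omega
  obtain ⟨h0, h1, h2, h3, h4, h5⟩ := key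
  fin_cases i <;> fin_cases j <;> first | assumption | exact absurd rfl hij

theorem Packs.balance_nonneg {v : ℕ} {s : Multiset (ItemType 3 × Fin 3)} (h : Packs v s)
    (hs : s.card ≤ 31) (hv : isNonneg v = true) (i j : Fin 3) : 0 ≤ balance s i j := by
  rcases eq_or_ne i j with rfl | hij
  · rw [balance_self]
  · refine nonneg_of_isNonneg h (fun i j => ?_) hv i j hij
    have := abs_balance_le s i j
    omega

/-- Adding `unitCode` raises every balance by one, which reduces the bound −1 to the sign test. -/
theorem Packs.neg_one_le_balance {v : ℕ} {s : Multiset (ItemType 3 × Fin 3)} (h : Packs v s)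
    (hs : s.card ≤ 30) (hv : isNonneg (v + unitCode) = true) (i j : Fin 3) :
    -1 ≤ balance s i j := by
  rcases eq_or_ne i j with rfl | hij
  · rw [balance_self]; norm_num
  · have h' : ((v + unitCode : ℕ) : ℤ) = signMask + packSum fun i j => balance s i j + 1 := by
      unfold Packs at h
      simp only [packSum, unitCode, signMask] at *
      omega
    have := nonneg_of_isNonneg h' (fun i j => by have := abs_balance_le s i j; omega) hv i j hij
    omega

/-! ### The search -/

/-- An item with the code `x` can be added to one of the packed balances so that all balances are
nonnegative. -/
def completes (R : List ℕ) (x : ItemCode) : Bool :=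
  R.any fun v => isNonneg (addCode v x.1) || isNonneg (addCode v x.2.1) ||
    isNonneg (addCode v x.2.2)

/-- The items with the codes in the list can be added to the packed balances `v` so that all
balances are at least `-1`. -/
def solves : List ItemCode → ℕ → Bool
  | [], v => isNonneg (v + unitCode)
  | x :: l, v => solves l (addCode v x.1) || solves l (addCode v x.2.1) ||
      solves l (addCode v x.2.2)

/-- The packed balances that arise when an item with the code `x` is added to one of the packed
balances or left out, restricted to those with all balances at least `-1`. -/
def extend (R : List ℕ) (x : ItemCode) : List ℕ :=
  R.flatMap fun v => [v, addCode v x.1, addCode v x.2.1, addCode v x.2.2].filter fun v =>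
    isNonneg (v + unitCode)

/-- Depth-first search through all multisets of items that extend `l` by items with codes in
`cands` and contain no nonempty part that can be assigned with nonnegative balances, verifying that
each can be assigned with balances at least `-1`. -/
def search : ℕ → List ItemCode → List ItemCode → List ℕ → Bool
  | 0, _, _, _ => false
  | n + 1, cands, l, R =>
    solves l signMask && (cands.filter fun x => !completes R x).tails.all fun
      | [] => true
      | x :: cs => search n (x :: cs) (x :: l) (extend R x)

/-- The codes of all items. -/
def allCodes : List ItemCode := do
  let a ← [false, true]
  let b ← [false, true]
  let c ← [false, true]
  let d ← [false, true]
  let e ← [false, true]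
  let f ← [false, true]
  return encodePrefs a b c d e f

theorem itemCode_mem_allCodes (t : ItemType 3) : itemCode t ∈ allCodes := by
  unfold itemCode
  generalize prefers t 0 1 = a
  generalize prefers t 0 2 = b
  generalize prefers t 1 0 = c
  generalize prefers t 1 2 = d
  generalize prefers t 2 0 = e
  generalize prefers t 2 1 = f
  revert a b c d e f
  decide +kernel

-- The fuel runs out, with value `false`, on reaching a list of seven items; success thus also
-- bounds the size of the multisets without a balanced part. The list `[signMask]` stands for the
-- empty assignment.
set_option maxRecDepth 100000 in
theorem search_allCodes : search 7 allCodes [] [signMask] = true := by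
  decide +kernel

/-! ### Soundness of the search -/

theorem exists_of_solves (L : List (ItemType 3)) {v : ℕ} {s : Multiset (ItemType 3 × Fin 3)}
    (h : Packs v s) (hL : L.length + s.card ≤ 30) (hv : solves (L.map itemCode) v = true) :
    ∃ s' : Multiset (ItemType 3 × Fin 3), s'.map Prod.fst = s.map Prod.fst + L ∧
      ∀ i j, -1 ≤ balance s' i j := by
  induction L generalizing v s with
  | nil => exact ⟨s, by simp, h.neg_one_le_balance (by simpa using hL) hv⟩
  | cons t L ih =>
    have step (p : Fin 3) (hp : solves (L.map itemCode) (addCode v ((itemCode t).get p)) = true) :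
        ∃ s' : Multiset (ItemType 3 × Fin 3), s'.map Prod.fst = s.map Prod.fst + (t :: L : List _) ∧
          ∀ i j, -1 ≤ balance s' i j := by
      rw [List.length_cons] at hL
      obtain ⟨s', h1, h2⟩ := ih (h.cons (by omega) t p)
        (by rw [Multiset.card_cons]; omega) hp
      refine ⟨s', ?_, h2⟩
      rw [h1, Multiset.map_cons, ← Multiset.cons_coe, Multiset.cons_add, Multiset.add_cons]
    simp only [List.map_cons, solves, Bool.or_eq_true] at hv
    rcases hv with (hv | hv) | hv
    · exact step 0 hv
    · exact step 1 hv
    · exact step 2 hv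

/-- Every packed balance in `R` is that of an assignment of some of the items `L`. -/
def PacksParts (R : List ℕ) (L : List (ItemType 3)) : Prop :=
  ∀ v ∈ R, ∃ s, Packs v s ∧ s.map Prod.fst ≤ (L : Multiset (ItemType 3))

theorem PacksParts.card_le {L : List (ItemType 3)} {s : Multiset (ItemType 3 × Fin 3)}
    (h : s.map Prod.fst ≤ (L : Multiset (ItemType 3))) : s.card ≤ L.length := by
  simpa using Multiset.card_le_card h

/-- The pruning in `extend` is harmless: `R` need not list all partial assignments, as long as each
entry comes from one. -/
theorem PacksParts.extend {R : List ℕ} {L : List (ItemType 3)} (h : PacksParts R L)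
    (hL : L.length ≤ 30) (t : ItemType 3) : PacksParts (extend R (itemCode t)) (t :: L) := by
  intro v hv
  obtain ⟨v', hv', hv⟩ := List.mem_flatMap.1 hv
  obtain ⟨s, hs, hsL⟩ := h v' hv'
  have hcard := PacksParts.card_le hsL
  have step (p : Fin 3) : ∃ s, Packs (addCode v' ((itemCode t).get p)) s ∧
      s.map Prod.fst ≤ ((t :: L : List _) : Multiset (ItemType 3)) :=
    ⟨(t, p) ::ₘ s, hs.cons (by omega) t p, by
      rw [Multiset.map_cons, ← Multiset.cons_coe]
      exact Multiset.cons_le_cons t hsL⟩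
  have hv := (List.mem_filter.1 hv).1
  simp only [List.mem_cons, List.not_mem_nil, or_false] at hv
  rcases hv with hv | hv | hv | hv <;> rw [hv]
  · exact ⟨s, hs, hsL.trans (by rw [← Multiset.cons_coe]; exact Multiset.le_cons_self _ _)⟩
  · exact step 0
  · exact step 1
  · exact step 2

theorem PacksParts.exists_of_completes {R : List ℕ} {L : List (ItemType 3)} (h : PacksParts R L)
    (hL : L.length ≤ 30) {t : ItemType 3} (ht : completes R (itemCode t) = true) :
    ∃ b : Multiset (ItemType 3 × Fin 3), b ≠ 0 ∧ b.map Prod.fst ≤ t ::ₘ (L : Multiset _) ∧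
      ∀ i j, 0 ≤ balance b i j := by
  obtain ⟨v, hv, hvt⟩ := List.any_eq_true.1 ht
  obtain ⟨s, hs, hsL⟩ := h v hv
  have hcard := PacksParts.card_le hsL
  have step (p : Fin 3) (hp : isNonneg (addCode v ((itemCode t).get p)) = true) :
      ∃ b : Multiset (ItemType 3 × Fin 3), b ≠ 0 ∧ b.map Prod.fst ≤ t ::ₘ (L : Multiset _) ∧
        ∀ i j, 0 ≤ balance b i j :=
    ⟨(t, p) ::ₘ s, Multiset.cons_ne_zero, by
      rw [Multiset.map_cons]
      exact Multiset.cons_le_cons t hsL,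
      (hs.cons (by omega) t p).balance_nonneg (by rw [Multiset.card_cons]; omega) hp⟩
  simp only [Bool.or_eq_true] at hvt
  rcases hvt with (hv | hv) | hv
  · exact step 0 hv
  · exact step 1 hv
  · exact step 2 hv

/-- A nonempty multiset with labels in a list has an element whose label is the first one to occur
in the list. -/
theorem exists_mem_tails {α β : Type*} (f : α → β) {S : Multiset α} (hS : S ≠ 0) (l : List β)
    (h : ∀ t ∈ S, f t ∈ l) :
    ∃ t ∈ S, ∃ cs, f t :: cs ∈ l.tails ∧ ∀ u ∈ S, f u ∈ f t :: cs := by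
  classical
  induction l with
  | nil =>
    obtain ⟨t, ht⟩ := Multiset.exists_mem_of_ne_zero hS
    exact absurd (h t ht) List.not_mem_nil
  | cons x l ih =>
    by_cases hx : ∃ t ∈ S, f t = x
    · obtain ⟨t, ht, rfl⟩ := hx
      exact ⟨t, ht, l, by simp, h⟩
    · push Not at hx
      obtain ⟨t, ht, cs, hcs, hu⟩ := ih fun t ht =>
        (List.mem_cons.1 (h t ht)).resolve_left (hx t ht)
      refine ⟨t, ht, cs, ?_, hu⟩
      rw [List.mem_tails] at hcs ⊢
      exact hcs.trans (List.suffix_cons x l)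

/-- `L` holds the items chosen so far and `S` those still to come. If an item of `S` completes a
balanced part, that part is the first alternative. Otherwise all of `S` survives the filter, and one
item moves from `S` to `L`. Once `S` is empty, `solves` gives the second alternative. -/
theorem search_sound (n : ℕ) (cands : List ItemCode) (L : List (ItemType 3)) (R : List ℕ)
    (hn : n + L.length ≤ 30) (hR : PacksParts R L)
    (h : search n cands (L.map itemCode) R = true) (S : Multiset (ItemType 3))
    (hS : ∀ t ∈ S, itemCode t ∈ cands) :
    (∃ b : Multiset (ItemType 3 × Fin 3), b ≠ 0 ∧ b.map Prod.fst ≤ S + L ∧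
      ∀ i j, 0 ≤ balance b i j) ∨
    ∃ s : Multiset (ItemType 3 × Fin 3), s.map Prod.fst = S + L ∧
      ∀ i j, -1 ≤ balance s i j := by
  induction n generalizing cands L R S with
  | zero => simp [search] at h
  | succ n ih =>
    rw [search, Bool.and_eq_true, List.all_eq_true] at h
    obtain ⟨hsolve, hall⟩ := h
    rcases eq_or_ne S 0 with rfl | hS0
    · right
      obtain ⟨s, h1, h2⟩ := exists_of_solves L packs_zero (by simp; omega) hsolve
      exact ⟨s, by simpa using h1, h2⟩
    by_cases hc : ∃ t ∈ S, completes R (itemCode t) = true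
    · left
      obtain ⟨t, htS, ht⟩ := hc
      obtain ⟨b, hb0, hb, hb'⟩ := hR.exists_of_completes (by omega) ht
      refine ⟨b, hb0, hb.trans ?_, hb'⟩
      rw [← Multiset.singleton_add]
      exact add_le_add (Multiset.singleton_le.2 htS) le_rfl
    · push Not at hc
      -- The search visits codes in list order, so the item to move is one whose code comes first;
      -- the rest of `S` then stays within the same tail, repetitions included.
      obtain ⟨t, htS, cs, hcs, hu⟩ := exists_mem_tails itemCode hS0
        (cands.filter fun x => !completes R x)
        fun t ht => List.mem_filter.2 ⟨hS t ht, by simpa using hc t ht⟩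
      obtain ⟨S', rfl⟩ := Multiset.exists_cons_of_mem htS
      have := ih (itemCode t :: cs) (t :: L) (extend R (itemCode t))
        (by rw [List.length_cons]; omega) (hR.extend (by omega) t) (hall _ hcs) S'
        fun u hu' => hu u (Multiset.mem_cons_of_mem hu')
      rwa [← Multiset.cons_coe, Multiset.add_cons, ← Multiset.cons_add] at this

/-- Any items can be assigned to the agents so that no agent is behind another by more than one
item. -/
theorem exists_balance_ge (S : Multiset (ItemType 3)) :
    ∃ s : Multiset (ItemType 3 × Fin 3), s.map Prod.fst = S ∧ ∀ i j, -1 ≤ balance s i j := by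
  induction hc : S.card using Nat.strong_induction_on generalizing S with
  | _ n ih =>
    rcases search_sound 7 allCodes [] [signMask] (by simp)
      (fun v hv => ⟨0, by rw [List.mem_singleton.1 hv]; exact packs_zero, by simp⟩)
      search_allCodes S (fun t _ => itemCode_mem_allCodes t) with ⟨b, hb0, hb, hb'⟩ | h
    · rw [Multiset.coe_nil, add_zero] at hb
      obtain ⟨S', rfl⟩ := Multiset.le_iff_exists_add.1 hb
      have hpos : 0 < b.card := Multiset.card_pos.2 hb0
      rw [Multiset.card_add, Multiset.card_map] at hc
      obtain ⟨s, hs, hs'⟩ := ih S'.card (by omega) S' rfl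
      refine ⟨b + s, by rw [Multiset.map_add, hs], fun i j => ?_⟩
      have h1 := hb' i j
      have h2 := hs' i j
      rw [balance_add]
      omega
    · simpa using h

/-! ### Two-pass transducers as Turing machines -/

/-- A device with finite memory that reads a word once from left to right, and then once more from
right to left, while writing one symbol for each symbol that it reads. -/
structure TwoPass (α β : Type) where
  /-- the memory during the first pass -/
  Count : Type
  /-- the memory during the second pass -/
  State : Type
  [countFintype : Fintype Count]
  [stateFintype : Fintype State]
  start : Count
  count : Count → α → Count
  turn : Count → State
  next : State → α → State
  out : State → α → β

namespace TwoPass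

variable {α β : Type} (T : TwoPass α β)

/-- The symbols written in a pass over a word. -/
def write : T.State → List α → List β
  | _, [] => []
  | s, a :: l => T.out s a :: write (T.next s a) l

theorem write_cons (s : T.State) (a : α) (l : List α) :
    T.write s (a :: l) = T.out s a :: T.write (T.next s a) l := rfl

theorem length_write (s : T.State) (l : List α) : (T.write s l).length = l.length := by
  induction l generalizing s with
  | nil => rfl
  | cons a l ih => simp [write, ih]

/-- The output word. -/
def output (l : List α) : List β :=
  (T.write (T.turn (l.foldl T.count T.start)) l.reverse).reverse

theorem length_output (l : List α) : (T.output l).length = l.length := by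
  simp [output, length_write]

/-- The stacks of the Turing machine of a two-pass transducer. -/
inductive Stack
  | input
  | work
  | output
  deriving DecidableEq

instance : Fintype Stack :=
  ⟨{.input, .work, .output}, fun k => by cases k <;> simp⟩

/-- The alphabets of the stacks. -/
def Alphabet (α β : Type) : Stack → Type
  | .input => α
  | .work => α
  | .output => β

/-- The contents of the stacks. -/
def contents (l w : List α) (o : List β) : ∀ k, List (Alphabet α β k)
  | .input => l
  | .work => w
  | .output => o

/-- The internal states of the Turing machine: the last symbol that was read, and the memories of
the transducer. -/
abbrev Memory : Type := Option α × T.Count × T.State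

section Machine

variable [Inhabited α] [Inhabited β]

open Turing.TM2.Stmt in
/-- The program of the Turing machine, where the label tells whether the first pass is over. -/
def program : Bool → Turing.TM2.Stmt (Alphabet α β) Bool T.Memory
  | false =>
    pop Stack.input (fun v x => (x, v.2)) <|
    branch (fun v => v.1.isSome)
      (push Stack.work (fun v => v.1.getD (default : α)) <|
        load (fun v => (none, v.1.elim v.2.1 (T.count v.2.1), v.2.2)) <|
        goto fun _ => false)
      (load (fun v => (none, v.2.1, T.turn v.2.1)) <| goto fun _ => true)
  | true =>
    pop Stack.work (fun v x => (x, v.2)) <|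
    branch (fun v => v.1.isSome)
      (push Stack.output (fun v => v.1.elim (default : β) (T.out v.2.2)) <|
        load (fun v => (none, v.2.1, v.1.elim v.2.2 (T.next v.2.2))) <|
        goto fun _ => true)
      (load (fun _ => (none, T.start, T.turn T.start)) halt)

/-- The configurations of the Turing machine between two symbols. -/
def cfg (b : Option Bool) (c : T.Count) (s : T.State) (l w : List α) (o : List β) :
    Turing.TM2.Cfg (Alphabet α β) Bool T.Memory :=
  ⟨b, (none, c, s), contents l w o⟩

theorem step_read (c : T.Count) (s : T.State) (a : α) (l w : List α) (o : List β) :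
    Turing.TM2.step T.program (T.cfg (some false) c s (a :: l) w o) =
      some (T.cfg (some false) (T.count c a) s l (a :: w) o) := by
  refine congrArg (fun S => some (Turing.TM2.Cfg.mk _ _ S)) (funext fun k => ?_)
  cases k <;> rfl

theorem step_turn (c : T.Count) (s : T.State) (w : List α) (o : List β) :
    Turing.TM2.step T.program (T.cfg (some false) c s [] w o) =
      some (T.cfg (some true) c (T.turn c) [] w o) := by
  refine congrArg (fun S => some (Turing.TM2.Cfg.mk _ _ S)) (funext fun k => ?_)
  cases k <;> rfl

theorem step_write (c : T.Count) (s : T.State) (a : α) (w : List α) (o : List β) :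
    Turing.TM2.step T.program (T.cfg (some true) c s [] (a :: w) o) =
      some (T.cfg (some true) c (T.next s a) [] w (T.out s a :: o)) := by
  refine congrArg (fun S => some (Turing.TM2.Cfg.mk _ _ S)) (funext fun k => ?_)
  cases k <;> rfl

theorem step_halt (c : T.Count) (s : T.State) (o : List β) :
    Turing.TM2.step T.program (T.cfg (some true) c s [] [] o) =
      some (T.cfg none T.start (T.turn T.start) [] [] o) := by
  refine congrArg (fun S => some (Turing.TM2.Cfg.mk _ _ S)) (funext fun k => ?_)
  cases k <;> rfl

/-- One step for each symbol and one to turn around. The work stack ends up holding the word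
reversed. -/
theorem iterate_read (c : T.Count) (s : T.State) (l w : List α) (o : List β) :
    (flip bind (Turing.TM2.step T.program))^[l.length + 1]
      (some (T.cfg (some false) c s l w o)) =
      some (T.cfg (some true) (l.foldl T.count c) (T.turn (l.foldl T.count c)) []
        (l.reverse ++ w) o) := by
  induction l generalizing c w with
  | nil => exact T.step_turn c s w o
  | cons a l ih =>
    rw [List.length_cons, Function.iterate_succ_apply]
    have : flip bind (Turing.TM2.step T.program) (some (T.cfg (some false) c s (a :: l) w o)) =
        some (T.cfg (some false) (T.count c a) s l (a :: w) o) := T.step_read c s a l w o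
    rw [this, ih]
    simp

theorem iterate_write (c : T.Count) (s : T.State) (w : List α) (o : List β) :
    (flip bind (Turing.TM2.step T.program))^[w.length + 1]
      (some (T.cfg (some true) c s [] w o)) =
      some (T.cfg none T.start (T.turn T.start) [] [] ((T.write s w).reverse ++ o)) := by
  induction w generalizing s o with
  | nil => exact T.step_halt c s o
  | cons a w ih =>
    rw [List.length_cons, Function.iterate_succ_apply]
    have : flip bind (Turing.TM2.step T.program) (some (T.cfg (some true) c s [] (a :: w) o)) =
        some (T.cfg (some true) c (T.next s a) [] w (T.out s a :: o)) := T.step_write c s a w o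
    rw [this, ih]
    simp [write]

variable [Fintype α]

/-- The Turing machine of a two-pass transducer. -/
def machine : Turing.FinTM2 where
  K := Stack
  k₀ := .input
  k₁ := .output
  Γ := Alphabet α β
  Λ := Bool
  main := false
  σ := T.Memory
  initialState := (none, T.start, T.turn T.start)
  σFin := @instFintypeProd _ _ _ (@instFintypeProd _ _ T.countFintype T.stateFintype)
  Γk₀Fin := inferInstanceAs (Fintype α)
  m := T.program

theorem initList_machine (l : List α) :
    Turing.initList T.machine l = T.cfg (some false) T.start (T.turn T.start) l [] [] := by
  unfold Turing.initList cfg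
  congr 1
  funext k
  cases k <;> rfl

/-- `Turing.haltList` prescribes the initial internal state, which is why the program resets its
memories before halting. -/
theorem haltList_machine (o : List β) :
    Turing.haltList T.machine o = T.cfg none T.start (T.turn T.start) [] [] o := by
  unfold Turing.haltList cfg
  congr 1
  funext k
  cases k <;> rfl

/-- The Turing machine of a two-pass transducer computes its output in linear time. -/
def outputsInTime (l : List α) :
    Turing.TM2OutputsInTime T.machine l (some (T.output l)) (2 * l.length + 2) where
  steps := (l.length + 1) + (l.length + 1)
  evals_in_steps := by
    have h1 := T.iterate_read T.start (T.turn T.start) l [] []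
    have h2 := T.iterate_write (l.foldl T.count T.start) (T.turn (l.foldl T.count T.start))
      l.reverse []
    rw [List.length_reverse] at h2
    rw [List.append_nil] at h1 h2
    have h3 := Function.iterate_add_apply (flip bind (Turing.TM2.step T.program)) (l.length + 1)
      (l.length + 1) (some (T.cfg (some false) T.start (T.turn T.start) l [] []))
    rw [h1, h2] at h3
    exact (congrArg (fun c => (flip bind T.machine.step)^[_] (some c)) (T.initList_machine l)).trans
      (h3.trans (congrArg some (T.haltList_machine (T.output l)).symm))
  steps_le_m := by omega

end Machine

end TwoPass

/-! ### Balanced allocations are EFX -/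

/-- The absence of weak-chores excludes V_i(i,a) = 0 with V_i(j,a) = 1, the one case in which the
difference would have the opposite sign. -/
theorem effect_eq_sub (I : BinaryNoChoreInstance 3) (i j p : Fin 3) (a : Fin I.1.numItems) :
    (effect (fun i j => decide (I.1.V i j a = 1)) p i j : ℝ) =
      I.1.V i p a - I.1.V i (Equiv.swap i j p) a := by
  have hle : ¬ I.1.V i i a < I.1.V i j a := fun h => I.2.2 i a ⟨j, h⟩
  have hi := I.2.1 i i a
  have hj := I.2.1 i j a
  rcases eq_or_ne i j with rfl | hij
  · simp [effect, prefers]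
  rcases eq_or_ne p i with rfl | hpi
  · rw [Equiv.swap_apply_left]
    rcases hi with hi | hi <;> rcases hj with hj | hj <;> simp_all [effect, prefers]
  rcases eq_or_ne p j with rfl | hpj
  · rw [Equiv.swap_apply_right]
    rcases hi with hi | hi <;> rcases hj with hj | hj <;> simp_all [effect, prefers]
  · rw [Equiv.swap_apply_of_ne_of_ne hpi hpj]
    simp [effect, hpi, hpj]

theorem isEFX_of_balanced (I : BinaryNoChoreInstance 3) (π : I.1.Allocation)
    (h : ∀ i j, -1 ≤ ∑ a, effect (fun i j => decide (I.1.V i j a = 1)) (π a) i j) :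
    I.1.IsEFX π := by
  intro i j hlt a ha
  let e : Fin I.1.numItems → ℤ := fun a =>
    effect (fun i j => decide (I.1.V i j a = 1)) (π a) i j
  have key (S : Finset (Fin I.1.numItems)) :
      I.1.valueOn S i π - I.1.valueOn S i (I.1.swapBundles π i j) = ((∑ b ∈ S, e b : ℤ) : ℝ) := by
    rw [Instance.valueOn, Instance.valueOn, ← Finset.sum_sub_distrib, Int.cast_sum]
    exact Finset.sum_congr rfl fun b _ => (effect_eq_sub I i j (π b) b).symm
  have htotal := key Finset.univ
  have hwithout := key (Finset.univ.erase a)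
  have hsum : e a + ∑ b ∈ Finset.univ.erase a, e b = ∑ b, e b :=
    Finset.add_sum_erase _ _ (Finset.mem_univ a)
  have hij : -1 ≤ ∑ b, e b := h i j
  unfold Instance.value at hlt ha
  unfold Instance.valueWithout at ha ⊢
  rw [htotal, hwithout, gt_iff_lt, Int.cast_lt] at ha
  -- An integer strictly above a total that is at least −1 is nonnegative.
  have : (0 : ℝ) ≤ ((∑ b ∈ Finset.univ.erase a, e b : ℤ) : ℝ) := by
    rw [Int.cast_nonneg_iff]
    omega
  linarith

/-! ### The algorithm

The items of each type are counted modulo three. The first few items of each type, as many as the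
remainder says, are allocated according to a fixed table with balances at least `-1`, and the other
items of each type go to the three agents in turn, which does not change any balance. -/

/-- A balanced assignment of `r t` items of each type `t`. -/
noncomputable def residualAssignment (r : ItemType 3 → Fin 3) : Multiset (ItemType 3 × Fin 3) :=
  (exists_balance_ge (∑ t, Multiset.replicate (r t) t)).choose

theorem map_fst_residualAssignment (r : ItemType 3 → Fin 3) :
    (residualAssignment r).map Prod.fst = ∑ t, Multiset.replicate (r t) t :=
  (exists_balance_ge (∑ t, Multiset.replicate (r t) t)).choose_spec.1

theorem balance_residualAssignment (r : ItemType 3 → Fin 3) (i j : Fin 3) :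
    -1 ≤ balance (residualAssignment r) i j :=
  (exists_balance_ge (∑ t, Multiset.replicate (r t) t)).choose_spec.2 i j

/-- The agents who receive the items of type `t` in the balanced assignment. -/
noncomputable def residualAgents (r : ItemType 3 → Fin 3) (t : ItemType 3) : List (Fin 3) :=
  (((residualAssignment r).filter fun x => t = x.1).map Prod.snd).toList

theorem length_residualAgents (r : ItemType 3 → Fin 3) (t : ItemType 3) :
    (residualAgents r t).length = r t := by
  rw [residualAgents, Multiset.length_toList, Multiset.card_map, ← Multiset.count_map,
    map_fst_residualAssignment, Multiset.count_sum']
  simp [Multiset.count_replicate]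

theorem sum_filter_fst {α β : Type*} [Fintype α] [DecidableEq α] (s : Multiset (α × β))
    (F : α → β → ℤ) :
    ∑ t, (((s.filter fun x => t = x.1).map Prod.snd).map (F t)).sum =
      (s.map fun x => F x.1 x.2).sum := by
  induction s using Multiset.induction_on with
  | empty => simp
  | cons x s ih =>
    rw [Multiset.map_cons, Multiset.sum_cons, ← ih]
    rw [← Finset.sum_erase_add _ _ (Finset.mem_univ x.1),
      ← Finset.sum_erase_add Finset.univ _ (Finset.mem_univ x.1)]
    rw [Multiset.filter_cons_of_pos (p := fun y : α × β => x.1 = y.1) _ rfl,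
      Multiset.map_cons, Multiset.map_cons,
      Multiset.sum_cons, add_left_comm]
    congr 2
    refine Finset.sum_congr rfl fun t ht => ?_
    rw [Multiset.filter_cons_of_neg (p := fun y : α × β => t = y.1) _
      (Finset.ne_of_mem_erase ht)]

/-- The agent who receives the item of type `t` that is preceded by `k` items of this type. -/
noncomputable def recipient (r : ItemType 3 → Fin 3) (t : ItemType 3) (k : ℕ) : Fin 3 :=
  if k < r t then (residualAgents r t).getD k 0 else Fin.ofNat 3 k

/-- `residualAgents r t` has exactly `r t` entries, so the default `0` in `recipient` is never used.
-/
theorem sum_recipient_remainder (r : ItemType 3 → Fin 3) (F : ItemType 3 → Fin 3 → ℤ) :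
    ∑ t, ∑ k ∈ Finset.range (r t), F t (recipient r t k) =
      ((residualAssignment r).map fun x => F x.1 x.2).sum := by
  rw [← sum_filter_fst]
  refine Finset.sum_congr rfl fun t _ => ?_
  have h : (((residualAssignment r).filter fun x => t = x.1).map Prod.snd) =
      (residualAgents r t : Multiset (Fin 3)) := (Multiset.coe_toList _).symm
  rw [h, Multiset.map_coe, Multiset.sum_coe, ← Fin.sum_univ_getElem, Finset.sum_range]
  refine Fintype.sum_equiv (finCongr (by simp [length_residualAgents])) _ _ fun k => ?_
  have hk : (k : ℕ) < (residualAgents r t).length := by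
    rw [length_residualAgents]; exact k.2
  simp [recipient, k.2, List.getElem?_eq_getElem hk]

/-- Beyond the first `r t` items, any three consecutive indices have all residues modulo 3, so each
agent is served once and `sum_effect` applies. -/
theorem sum_recipient (r : ItemType 3 → Fin 3) (t : ItemType 3) (q : ℕ) (i j : Fin 3) :
    ∑ k ∈ Finset.range (r t + 3 * q), effect t (recipient r t k) i j =
      ∑ k ∈ Finset.range (r t), effect t (recipient r t k) i j := by
  induction q with
  | zero => simp
  | succ q ih =>
    have h (d : ℕ) : recipient r t (r t + 3 * q + d) = Fin.ofNat 3 (r t + d) := by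
      rw [recipient, if_neg (by omega)]
      ext
      simp only [Fin.ofNat]
      omega
    rw [show (r t : ℕ) + 3 * (q + 1) = r t + 3 * q + 1 + 1 + 1 by ring, Finset.sum_range_succ,
      Finset.sum_range_succ, Finset.sum_range_succ, ih, add_assoc (_ + 3 * q) 1 1,
      ← add_zero ((r t : ℕ) + 3 * q), add_assoc _ 0, add_assoc _ 0, h, h, h]
    have hs := sum_effect t i j
    generalize r t = c
    fin_cases c <;> simp [Fin.ofNat] <;> linarith

/-- A counter that is exact up to `1` and counts modulo three from then on. -/
def boundedCount (k : ℕ) : Fin 5 := ⟨if k < 2 then k else 2 + (k - 2) % 3, by split_ifs <;> omega⟩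

/-- The successor for `boundedCount`. -/
def boundedSucc (c : Fin 5) : Fin 5 := if c = 4 then 2 else c + 1

theorem boundedSucc_boundedCount (k : ℕ) :
    boundedSucc (boundedCount k) = boundedCount (k + 1) := by
  rcases Nat.lt_or_ge k 2 with hk | hk
  · interval_cases k <;> rfl
  · obtain ⟨k, rfl⟩ := Nat.exists_eq_add_of_le' hk
    have key : ∀ m : Fin 3, boundedSucc ⟨2 + m, by omega⟩ = ⟨2 + (m + 1) % 3, by omega⟩ := by
      intro m
      fin_cases m <;> rfl
    have h1 : boundedCount (k + 2) = ⟨2 + k % 3, by omega⟩ := by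
      simp [boundedCount]
    have h2 : boundedCount (k + 2 + 1) = ⟨2 + (k + 1) % 3, by omega⟩ := by
      simp [boundedCount, show k + 2 + 1 - 2 = k + 1 by omega]
    rw [h1, h2]
    exact (key ⟨k % 3, Nat.mod_lt _ (by norm_num)⟩).trans (Fin.ext (by simp))

/-- Since `r t ≤ 2`, the test `k < r t` fails for all `k ≥ 2`, where only `k` modulo 3 matters;
`boundedCount` preserves it. -/
theorem recipient_boundedCount (r : ItemType 3 → Fin 3) (t : ItemType 3) (k : ℕ) :
    recipient r t (boundedCount k) = recipient r t k := by
  have hr := (r t).2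
  have hk : (boundedCount k : ℕ) = if k < 2 then k else 2 + (k - 2) % 3 := rfl
  split_ifs at hk with h
  · rw [hk]
  · rw [recipient, recipient, if_neg (by omega), if_neg (by omega)]
    ext
    simp only [Fin.ofNat]
    omega

/-- The transducer that computes EFX allocations. -/
noncomputable abbrev allocator : TwoPass (ItemType 3) (Fin 3) where
  Count := ItemType 3 → Fin 3
  State := (ItemType 3 → Fin 3) × (ItemType 3 → Fin 5)
  start := 0
  count c t := Function.update c t (c t + 1)
  turn r := (r, 0)
  next s t := (s.1, Function.update s.2 t (boundedSucc (s.2 t)))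
  out s t := recipient s.1 t (s.2 t)

/-! ### Balances of the transducer's output -/

theorem foldl_count (l : List (ItemType 3)) (c : ItemType 3 → Fin 3) (t : ItemType 3) :
    ((l.foldl allocator.count c t : Fin 3) : ℕ) = (c t + l.count t) % 3 := by
  induction l generalizing c with
  | nil => simp [Nat.mod_eq_of_lt (c t).2]
  | cons a l ih =>
    rw [List.foldl_cons, ih]
    rcases eq_or_ne t a with rfl | h
    · simp [Fin.val_add]
      omega
    · simp [Function.update_of_ne h, List.count_cons_of_ne h.symm]

/-- Regroups the sum along the word by item type. Here `n t` is the number of items of type `t`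
already processed, left arbitrary for the induction. -/
theorem sum_write (r : ItemType 3 → Fin 3) (n : ItemType 3 → ℕ) (l : List (ItemType 3))
    (F : ItemType 3 → Fin 3 → ℤ) :
    (List.zipWith F l (allocator.write (r, fun t => boundedCount (n t)) l)).sum =
      ∑ t, ∑ k ∈ Finset.Ico (n t) (n t + l.count t), F t (recipient r t k) := by
  induction l generalizing n with
  | nil => simp
  | cons a l ih =>
    have hnext : allocator.next (r, fun t => boundedCount (n t)) a =
        (r, fun t => boundedCount (Function.update n a (n a + 1) t)) := by
      refine Prod.ext rfl (funext fun t => ?_)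
      rcases eq_or_ne t a with rfl | h
      · simp [boundedSucc_boundedCount]
      · simp [Function.update_of_ne h]
    have hout : allocator.out (r, fun t => boundedCount (n t)) a = recipient r a (n a) :=
      recipient_boundedCount r a (n a)
    rw [TwoPass.write_cons, List.zipWith_cons_cons, List.sum_cons, hnext, ih, hout,
      ← Finset.add_sum_erase _ _ (Finset.mem_univ a),
      ← Finset.add_sum_erase Finset.univ (fun t => ∑ k ∈ Finset.Ico (n t) _, _)
        (Finset.mem_univ a), ← add_assoc]
    congr 1
    · rw [Function.update_self, List.count_cons_self,
        Finset.sum_eq_sum_Ico_succ_bot (b := n a + (l.count a + 1)) (by omega)]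
      congr 3
      omega
    · refine Finset.sum_congr rfl fun t ht => ?_
      have h := Finset.ne_of_mem_erase ht
      rw [Function.update_of_ne h, List.count_cons_of_ne h.symm]

theorem balanced_output (l : List (ItemType 3)) (i j : Fin 3) :
    -1 ≤ (List.zipWith (fun t p => effect t p i j) l (allocator.output l)).sum := by
  rw [← List.sum_reverse, List.reverse_zipWith (by rw [TwoPass.length_output]), TwoPass.output,
    List.reverse_reverse]
  set r : ItemType 3 → Fin 3 := l.foldl allocator.count allocator.start with hr
  -- The second pass reads the word backwards, which leaves the number of items of each type
  -- unchanged.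
  have h := sum_write r (fun _ => 0) l.reverse fun t p => effect t p i j
  have hturn : allocator.turn r = (r, fun _ => boundedCount 0) := rfl
  rw [hturn, h]
  have hmod (t : ItemType 3) : (r t : ℕ) + 3 * (l.count t / 3) = l.count t := by
    have := foldl_count l allocator.start t
    rw [hr, this]
    simp only [Pi.zero_apply, Fin.val_zero, zero_add]
    omega
  have hsum (t : ItemType 3) : ∑ k ∈ Finset.Ico 0 (0 + l.reverse.count t),
      effect t (recipient r t k) i j =
      ∑ k ∈ Finset.range (r t), effect t (recipient r t k) i j := by
    rw [zero_add, List.count_reverse, ← hmod t, ← sum_recipient, Finset.range_eq_Ico]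
  rw [Finset.sum_congr rfl fun t _ => hsum t,
    sum_recipient_remainder r fun t p => effect t p i j]
  exact balance_residualAssignment r i j

/-! ### From output words to allocations -/

theorem length_encodeInstance {n : ℕ} (I : BinaryNoChoreInstance n) :
    (encodeInstance I).length = I.1.numItems := by
  simp [encodeInstance]

/-- The allocation that the transducer computes. -/
noncomputable def efxAllocation (I : BinaryNoChoreInstance 3) : I.1.Allocation := fun a =>
  (allocator.output (encodeInstance I))[a]'(by
    rw [TwoPass.length_output, length_encodeInstance]; exact a.2)

theorem encodeAllocation_efxAllocation (I : BinaryNoChoreInstance 3) :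
    encodeAllocation ⟨I.1.numItems, efxAllocation I⟩ = allocator.output (encodeInstance I) := by
  refine List.ext_getElem ?_ fun k h1 h2 => ?_
  · simp [encodeAllocation, TwoPass.length_output, length_encodeInstance]
  · simp [encodeAllocation, efxAllocation]

theorem isEFX_efxAllocation (I : BinaryNoChoreInstance 3) : I.1.IsEFX (efxAllocation I) := by
  refine isEFX_of_balanced I _ fun i j => ?_
  have h := balanced_output (encodeInstance I) i j
  rw [← encodeAllocation_efxAllocation] at h
  convert h
  rw [← List.sum_ofFn]
  congr 1
  refine List.ext_getElem ?_ fun k h1 h2 => ?_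
  · simp [encodeAllocation, encodeInstance]
  · simp [encodeAllocation, encodeInstance]

theorem computableInPolyTime_efxAllocation : ComputableInPolyTime efxAllocation := by
  refine ⟨{ tm := allocator.machine
            inputAlphabet := Equiv.refl (ItemType 3)
            outputAlphabet := Equiv.refl (Fin 3)
            time := 2 * Polynomial.X + 2
            outputsFun := fun I => ?_ }, ?_⟩
  · have h := allocator.outputsInTime (encodeInstance I)
    rw [← encodeAllocation_efxAllocation] at h
    have h2 : (2 * Polynomial.X + 2 : Polynomial ℕ).eval (encodeInstance I).length =
      2 * (encodeInstance I).length + 2 := by simp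
    rw [h2]
    have hin : (encodeInstance I).map (Equiv.refl (ItemType 3)).invFun = encodeInstance I :=
      List.map_id _
    have hout : (encodeAllocation ⟨I.1.numItems, efxAllocation I⟩).map
        (Equiv.refl (Fin 3)).invFun = encodeAllocation ⟨I.1.numItems, efxAllocation I⟩ :=
      List.map_id _
    exact cast (congrArg₂ (fun l o => Turing.TM2OutputsInTime allocator.machine l (some o) _)
      hin.symm hout.symm) h
  · rintro (_ | _ | _)
    · exact inferInstanceAs (Finite (ItemType 3))
    · exact inferInstanceAs (Finite (ItemType 3))
    · exact inferInstanceAs (Finite (Fin 3))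

end FairDivision

theorem mainTheorem8 :
    (∀ I : FairDivision.Instance 3, I.IsBinary → I.NoWeakChores →
      ∃ π : I.Allocation, I.IsEFX π) ∧
    (∃ f : (I : FairDivision.BinaryNoChoreInstance 3) → I.1.Allocation,
      (∀ I : FairDivision.BinaryNoChoreInstance 3, I.1.IsEFX (f I)) ∧ FairDivision.ComputableInPolyTime f) :=
  ⟨fun I hI hI' => ⟨_, FairDivision.isEFX_efxAllocation ⟨I, hI, hI'⟩⟩,
    FairDivision.efxAllocation, FairDivision.isEFX_efxAllocation,
    FairDivision.computableInPolyTime_efxAllocation⟩
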